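/- Let $\mathcal{A}=x^2-x\frac{d}{dx}\,x\frac{d}{dx}$, and for $n\in\mathbb{N}_0$ let $p_n$ be the polynomial $p_n(x)=(-1)^n e^{x}\mathcal{A}^n e^{-x}=\sum_{k=0}^n c_{n,k}x^k$. Let $t(n,\nu)$ be the central factorial numbers of the first kind, given by $t(n,\nu)=t(n-2,\nu-2)-\frac14(n-2)^2\,t(n-2,\nu)$ for $n\ge 2$, with $t(0,\nu)=\delta_{\nu,0}$, $t(1,\nu)=\delta_{\nu,1}$, and $t(n,\nu)=0$ for $\nu<0$. For $k\ge 1$ let $$h_{2k+1}=\int_0^\infty \frac{\sinh x}{x\cosh^{2k+1}x}\,dx .$$ Then for every integer $n\ge 1$ the integral $h_{2n+1}$ converges absolutely, and the following reciprocal equalities hold: $$(2n)!\,\left(2^{2n+1}-1\right)\frac{\zeta(2n+1)}{(2\pi)^{2n}}=(-1)^n\sum_{k=1}^n 2^{-k}\,k!\,c_{n,k}\,h_{2k+1},$$ $$h_{2n+1}=\frac{(-1)^n4^n}{(2n)!}\sum_{k=1}^n(-1)^k\,t(2n,2k)\,(2k)!\,\left(2^{2k+1}-1\right)\frac{\zeta(2k+1)}{(2\pi)^{2k}}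 .$$ -/

import Mathlib

open Real MeasureTheory Polynomial

noncomputable section

namespace OddZeta

/-- The Bessel operator `A = x ^ 2 - x (d/dx) x (d/dx)` acting on real functions. -/
def besselOp (f : ℝ → ℝ) : ℝ → ℝ :=
  fun x => x ^ 2 * f x - x * deriv (fun y => y * deriv f y) x

theorem besselOp_exp_mul (q : ℝ[X]) :
    besselOp (fun y => exp (-y) * q.eval y) = fun y => exp (-y) *
      (X ^ 2 * q - X * (derivative (X * (derivative q - q)) - X * (derivative q - q))).eval y := by
  have key : ∀ r : ℝ[X], deriv (fun y => exp (-y) * r.eval y) =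
      fun y => exp (-y) * (derivative r - r).eval y := by
    intro r
    funext y
    have h1 : HasDerivAt (fun y : ℝ => exp (-y)) (exp (-y) * (-1)) y :=
      (hasDerivAt_neg y).exp
    refine (h1.fun_mul (r.hasDerivAt y)).deriv.trans ?_
    simp only [eval_sub]
    ring
  funext x
  have h2 : (fun y => y * deriv (fun z => exp (-z) * q.eval z) y) =
      fun y => exp (-y) * (X * (derivative q - q)).eval y := by
    funext y
    rw [key q]
    simp only [eval_mul, eval_X]
    ring
  simp only [besselOp]
  rw [h2, key]
  simp only [eval_mul, eval_X, eval_sub, eval_pow]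
  ring

theorem exists_besselPoly (n : ℕ) : ∃ P : ℝ[X], ∀ x : ℝ,
    P.eval x = (-1) ^ n * exp x * (besselOp^[n] (fun y => exp (-y))) x := by
  have h : ∃ Q : ℝ[X], besselOp^[n] (fun y => exp (-y)) = fun y => exp (-y) * Q.eval y := by
    induction n with
    | zero => exact ⟨1, by simp⟩
    | succ n ih =>
      obtain ⟨Q, hQ⟩ := ih
      exact ⟨_, by rw [Function.iterate_succ_apply', hQ, besselOp_exp_mul]⟩
  obtain ⟨Q, hQ⟩ := h
  refine ⟨C ((-1) ^ n) * Q, fun x => ?_⟩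
  rw [hQ, eval_mul, eval_C, mul_assoc, ← mul_assoc (exp x), ← exp_add]
  simp

/-- The polynomial `p_n(x) = (-1)^n e^x A^n e^{-x}`; the equation for all real `x` determines it. -/
def besselPoly (n : ℕ) : ℝ[X] := (exists_besselPoly n).choose

/-- The defining equation of `p_n`. -/
theorem besselPoly_eval (n : ℕ) (x : ℝ) : (besselPoly n).eval x =
    (-1) ^ n * exp x * (besselOp^[n] (fun y => exp (-y))) x :=
  (exists_besselPoly n).choose_spec x

/-- The coefficient `c_{n,k}` of `x^k` in `p_n(x)`. -/
def besselCoeff (n k : ℕ) : ℝ := (besselPoly n).coeff k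

/-- The central factorial numbers of the first kind `t(n, ν)`:
`t(n, ν) = t(n-2, ν-2) - (1/4) (n-2)^2 t(n-2, ν)`, `t(n, 0) = t(0, n) = δ_{n,0}`, `t(n, n) = 1`,
and `t(n, ν) = 0` when `ν > n` or when `n` and `ν` have different parities. -/
def centralFactorial : ℕ → ℕ → ℝ
  | 0, ν => if ν = 0 then 1 else 0
  | 1, ν => if ν = 1 then 1 else 0
  | _ + 2, 0 => 0
  | n + 2, 1 => -(1 / 4) * (n : ℝ) ^ 2 * centralFactorial n 1
  | n + 2, ν + 2 => centralFactorial n ν - (1 / 4) * (n : ℝ) ^ 2 * centralFactorial n (ν + 2)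

/-- The function `sinh x / (x cosh^m x)`. -/
def hIntegrand (m : ℕ) (x : ℝ) : ℝ := sinh x / (x * cosh x ^ m)

/-- The integral `h_m` of `sinh x / (x cosh^m x)` over `(0, ∞)`. -/
def h (m : ℕ) : ℝ := ∫ x in Set.Ioi (0 : ℝ), hIntegrand m x

end OddZeta

end

/-! Differentiate `π cot(πz)` an even number `2n` of times in two ways. The map sending `X ^ k` to
`2⁻ᵏ k! cos(πz) / sin(πz)^(2k+1)` turns `besselStep` into `-(4π²)⁻¹ d²/dz²`
(`exists_hasDerivAt_cotPoly`), so the derivative is a multiple of the image of `p_n`. By partial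
fractions it is also `(2n)! ∑ (z+m)^(-2n-1)`. On the line `z = 1/2 + ix/π`, sine and cosine become
`cosh x` and `-i sinh x`. Dividing by `x` and integrating over `x > 0` gives the sum of the
`h_{2k+1}` on one side. On the other, each pair of poles `±(m+1/2)` contributes `-iπ
(m+1/2)^(-2n-1)`, and these add up to a multiple of `ζ(2n+1)`. The second equality inverts the
first: since `(besselStep - j²) X^j = -(2j+1) X^(j+1)`, the product of `besselStep - j²` over `j <
n`, whose coefficients are `t(2n, 2k)`, carries `1` to a multiple of `X^n`
(`sum_centralFactorial_smul_besselPoly`). -/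

noncomputable section

namespace OddZeta

/-! ### The Bessel operator on polynomials -/

/-- The operator on polynomials induced by `-A` under conjugation with `exp (-x)`. -/
def besselStep : ℝ[X] →ₗ[ℝ] ℝ[X] where
  toFun q := X ^ 2 * derivative (derivative q) + X * derivative q - X * q - 2 * X ^ 2 * derivative q
  map_add' p q := by simp only [map_add]; ring
  map_smul' a q := by
    simp only [smul_eq_C_mul, RingHom.id_apply, derivative_C_mul]; ring

theorem besselStep_apply (q : ℝ[X]) : besselStep q =
    X ^ 2 * derivative (derivative q) + X * derivative q - X * q - 2 * X ^ 2 * derivative q := rfl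

theorem besselStep_X_pow (k : ℕ) :
    besselStep (X ^ k) = ((k : ℝ) ^ 2) • X ^ k - (2 * (k : ℝ) + 1) • X ^ (k + 1) := by
  rw [besselStep_apply, smul_eq_C_mul, smul_eq_C_mul]
  have hC : (C 2 : ℝ[X]) = 2 := rfl
  rcases k with - | - | k
  · simp
  · simp [hC]; ring
  · simp [hC]; ring

theorem besselPoly_zero : besselPoly 0 = 1 := by
  refine Polynomial.funext fun x => ?_
  rw [besselPoly_eval]
  simp [← exp_add]

theorem besselPoly_succ (n : ℕ) : besselPoly (n + 1) = besselStep (besselPoly n) := by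
  have h : besselOp^[n] (fun y => exp (-y)) =
      fun y => exp (-y) * (C ((-1) ^ n) * besselPoly n).eval y := by
    funext y
    have : (-1 : ℝ) ^ n * (-1) ^ n = 1 := by rw [← mul_pow]; simp
    have h2 : exp (-y) * exp y = 1 := by rw [← exp_add]; simp
    rw [eval_mul, eval_C, besselPoly_eval]
    linear_combination (-(besselOp^[n] (fun y => exp (-y)) y)) * this -
      (-1 : ℝ) ^ n * (-1) ^ n * (besselOp^[n] (fun y => exp (-y)) y) * h2
  refine Polynomial.funext fun x => ?_
  have h1 : (-1 : ℝ) ^ n * (-1) ^ n = 1 := by rw [← mul_pow]; simp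
  have h2 : exp x * exp (-x) = 1 := by rw [← exp_add]; simp
  rw [besselPoly_eval, Function.iterate_succ_apply', h, besselOp_exp_mul, besselStep_apply]
  simp only [derivative_mul, derivative_C, derivative_sub, derivative_X, eval_mul, eval_sub,
    eval_add, eval_X, eval_pow, eval_C, eval_ofNat, zero_mul, zero_add, one_mul]
  generalize (besselPoly n).eval x = a
  generalize (derivative (besselPoly n)).eval x = b
  generalize (derivative (derivative (besselPoly n))).eval x = c
  linear_combination (x ^ 2 * c + x * b - x * a - 2 * x ^ 2 * b) *
    (exp x * exp (-x) * h1 + h2)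

theorem natDegree_besselPoly_le (n : ℕ) : (besselPoly n).natDegree ≤ n := by
  induction n with
  | zero => simp [besselPoly_zero]
  | succ n ih =>
    rw [besselPoly_succ, besselStep_apply]
    have h1 : (derivative (besselPoly n)).natDegree ≤ n - 1 :=
      (natDegree_derivative_le _).trans (by omega)
    have h2 : (derivative (derivative (besselPoly n))).natDegree ≤ n - 1 - 1 :=
      (natDegree_derivative_le _).trans (by omega)
    -- For `n = 0` the truncated `n - 1` and `n - 1 - 1` give degree bounds that are too weak.
    rcases n with - | n
    · simp [besselPoly_zero]
    have e2 : (X ^ 2 * derivative (derivative (besselPoly (n + 1)))).natDegree ≤ n + 1 + 1 := by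
      refine natDegree_mul_le.trans ?_
      simp only [natDegree_X_pow]; omega
    have e1 : (X * derivative (besselPoly (n + 1))).natDegree ≤ n + 1 + 1 := by
      refine natDegree_mul_le.trans ?_
      simp only [natDegree_X]; omega
    have e0 : (X * besselPoly (n + 1)).natDegree ≤ n + 1 + 1 := by
      refine natDegree_mul_le.trans ?_
      simp only [natDegree_X]; omega
    have e3 : (2 * X ^ 2 * derivative (besselPoly (n + 1))).natDegree ≤ n + 1 + 1 := by
      refine natDegree_mul_le.trans ?_
      have : ((2 : ℝ[X]) * X ^ 2).natDegree ≤ 2 := by compute_degree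
      omega
    exact natDegree_sub_le_of_le (natDegree_sub_le_of_le (natDegree_add_le_of_degree_le e2 e1) e0) e3
      |>.trans (by simp)

/-- Each term of `besselStep` has a factor `X`. This removes the term `k = 0`, whose integral `h_1`
would diverge. -/
theorem besselPoly_coeff_zero {n : ℕ} (hn : 1 ≤ n) : (besselPoly n).coeff 0 = 0 := by
  obtain ⟨n, rfl⟩ : ∃ m, n = m + 1 := ⟨n - 1, by omega⟩
  rw [besselPoly_succ, besselStep_apply]
  simp [mul_coeff_zero]

/-! ### Inversion by central factorial numbers -/

theorem sum_range_comp_succ {M : Type*} [AddCommMonoid M] (f : ℕ → M) (n : ℕ) :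
    ∑ k ∈ Finset.range n, f (k + 1) = ∑ k ∈ Finset.Icc 1 n, f k := by
  rw [Finset.range_eq_Ico, Finset.sum_Ico_add' f 0 n 1]
  exact Finset.sum_congr (by ext; simp) fun _ _ => rfl

theorem centralFactorial_two_mul_succ_succ (n k : ℕ) :
    centralFactorial (2 * (n + 1)) (2 * (k + 1)) =
      centralFactorial (2 * n) (2 * k) - (n : ℝ) ^ 2 * centralFactorial (2 * n) (2 * (k + 1)) := by
  rw [show 2 * (n + 1) = 2 * n + 2 by ring, show 2 * (k + 1) = 2 * k + 2 by ring, centralFactorial]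
  push_cast; ring

theorem centralFactorial_two_mul_succ_zero (n : ℕ) :
    centralFactorial (2 * (n + 1)) 0 = 0 := by
  rw [show 2 * (n + 1) = 2 * n + 2 by ring, centralFactorial]

theorem centralFactorial_two_mul_eq_zero (n k : ℕ) (hk : n < k) :
    centralFactorial (2 * n) (2 * k) = 0 := by
  induction n generalizing k with
  | zero => simp [centralFactorial]; omega
  | succ n ih =>
    obtain ⟨k, rfl⟩ : ∃ m, k = m + 1 := ⟨k - 1, by omega⟩
    rw [centralFactorial_two_mul_succ_succ, ih k (by omega), ih (k + 1) (by omega)]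
    simp

theorem sq_mul_centralFactorial_zero (n : ℕ) :
    (n : ℝ) ^ 2 * centralFactorial (2 * n) 0 = 0 := by
  rcases n with - | n
  · simp
  · rw [centralFactorial_two_mul_succ_zero, mul_zero]

/-- The recurrence for `t(2n, 2k)` is multiplication of `∑ t(2n, 2k) T^k` by `T - n²`; with `T`
acting as `besselStep`, this factor kills the `X^n` part of `besselStep (X^n)`. -/
theorem sum_centralFactorial_smul_besselPoly (n : ℕ) :
    ∑ k ∈ Finset.range (n + 1), centralFactorial (2 * n) (2 * k) • besselPoly k =
      ((-1) ^ n * ∏ j ∈ Finset.range n, (2 * (j : ℝ) + 1)) • X ^ n := by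
  induction n with
  | zero => simp [centralFactorial, besselPoly_zero]
  | succ n ih =>
    have h1 : ∑ k ∈ Finset.range (n + 1 + 1),
          centralFactorial (2 * (n + 1)) (2 * k) • besselPoly k =
        besselStep (∑ k ∈ Finset.range (n + 1), centralFactorial (2 * n) (2 * k) • besselPoly k) -
        ((n : ℝ) ^ 2) •
          ∑ k ∈ Finset.range (n + 1), centralFactorial (2 * n) (2 * k) • besselPoly k := by
      rw [Finset.sum_range_succ']
      simp only [mul_zero, centralFactorial_two_mul_succ_zero, zero_smul, add_zero,
        centralFactorial_two_mul_succ_succ, sub_smul, Finset.sum_sub_distrib, map_sum, map_smul,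
        ← besselPoly_succ]
      congr 1
      have h2 : ∑ k ∈ Finset.range (n + 1), centralFactorial (2 * n) (2 * k) • besselPoly k =
          ∑ k ∈ Finset.range (n + 1 + 1), centralFactorial (2 * n) (2 * k) • besselPoly k := by
        rw [Finset.sum_range_succ _ (n + 1), centralFactorial_two_mul_eq_zero n (n + 1) (by omega)]
        simp
      rw [h2, Finset.sum_range_succ' _ (n + 1), smul_add, smul_smul, mul_zero,
        sq_mul_centralFactorial_zero, zero_smul, add_zero, Finset.smul_sum]
      simp only [smul_smul]
    rw [h1, ih, map_smul, besselStep_X_pow, Finset.prod_range_succ]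
    module

theorem two_pow_mul_factorial_mul_prod_odd (n : ℕ) :
    (2 : ℝ) ^ n * n.factorial * ∏ j ∈ Finset.range n, (2 * (j : ℝ) + 1) = (2 * n).factorial := by
  induction n with
  | zero => simp
  | succ n ih =>
    rw [show 2 * (n + 1) = 2 * n + 1 + 1 by ring, Nat.factorial_succ, Nat.factorial_succ,
      Nat.factorial_succ, Finset.prod_range_succ]
    push_cast
    rw [← ih]; ring

/-! ### Even derivatives of the cotangent -/

/-- The linear map from polynomials to functions that sends `X ^ k` to
`2⁻ᵏ k! cos (π z) / sin (π z) ^ (2 k + 1)`. -/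
def cotPoly (z : ℂ) : ℝ[X] →ₗ[ℝ] ℂ :=
  Polynomial.lsum fun k => LinearMap.toSpanSingleton ℝ ℂ
    (((2 : ℂ) ^ k)⁻¹ * k.factorial * (Complex.cos (π * z) * ((Complex.sin (π * z)) ^ (2 * k + 1))⁻¹))

theorem cotPoly_monomial (z : ℂ) (k : ℕ) (a : ℝ) : cotPoly z (monomial k a) =
    a * (((2 : ℂ) ^ k)⁻¹ * k.factorial *
      (Complex.cos (π * z) * ((Complex.sin (π * z)) ^ (2 * k + 1))⁻¹)) := by
  simp [cotPoly, Polynomial.sum_monomial_index]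

theorem hasDerivAt_sin_pi_mul (z : ℂ) :
    HasDerivAt (fun w : ℂ => Complex.sin (π * w)) (π * Complex.cos (π * z)) z := by
  have h := ((hasDerivAt_id z).const_mul (π : ℂ)).csin
  simpa [mul_comm] using h

theorem hasDerivAt_cos_pi_mul (z : ℂ) :
    HasDerivAt (fun w : ℂ => Complex.cos (π * w)) (-(π * Complex.sin (π * z))) z := by
  have h := ((hasDerivAt_id z).const_mul (π : ℂ)).ccos
  simpa [mul_comm] using h

theorem hasDerivAt_sin_pi_mul_pow_inv {z : ℂ} (hz : Complex.sin (π * z) ≠ 0) (m : ℕ) :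
    HasDerivAt (fun w : ℂ => ((Complex.sin (π * w)) ^ m)⁻¹)
      (-(m * π * Complex.cos (π * z) * ((Complex.sin (π * z)) ^ (m + 1))⁻¹)) z := by
  refine ((hasDerivAt_sin_pi_mul z).fun_pow m).fun_inv (pow_ne_zero _ hz) |>.congr_deriv ?_
  rcases m with - | m
  · simp
  · simp only [Nat.add_sub_cancel]
    field_simp
    ring

theorem hasDerivAt_cos_mul_sin_pow_inv {z : ℂ} (hz : Complex.sin (π * z) ≠ 0) (k : ℕ) :
    HasDerivAt (fun w : ℂ => Complex.cos (π * w) * ((Complex.sin (π * w)) ^ (2 * k + 1))⁻¹)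
      (π * (2 * k * ((Complex.sin (π * z)) ^ (2 * k))⁻¹ -
        (2 * k + 1) * ((Complex.sin (π * z)) ^ (2 * k + 2))⁻¹)) z := by
  refine (hasDerivAt_cos_pi_mul z).fun_mul (hasDerivAt_sin_pi_mul_pow_inv hz (2 * k + 1))
    |>.congr_deriv ?_
  have h := Complex.sin_sq_add_cos_sq (π * z)
  push_cast
  field_simp
  linear_combination (-(2 * (k : ℂ) + 1)) * Complex.sin (π * z) ^ (4 * k + 1) * h

/-- The weights `2⁻ᵏ k!` have consecutive ratio `(k+1)/2`, which turns the factor `(2k+1)(2k+2)` of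
the second derivative into `4(2k+1)`. The first derivative is no longer a value of `cotPoly`, hence
the existential. -/
theorem exists_hasDerivAt_cotPoly (q : ℝ[X]) : ∃ f : ℂ → ℂ, ∀ z, Complex.sin (π * z) ≠ 0 →
    HasDerivAt (fun w => cotPoly w q) (f z) z ∧
    HasDerivAt f (-(4 * π ^ 2) * cotPoly z (besselStep q)) z := by
  induction q using Polynomial.induction_on' with
  | add p q hp hq =>
    obtain ⟨f, hf⟩ := hp
    obtain ⟨g, hg⟩ := hq
    refine ⟨fun z => f z + g z, fun z hz => ⟨?_, ?_⟩⟩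
    · simpa only [map_add] using (hf z hz).1.fun_add (hg z hz).1
    · simpa only [map_add, mul_add] using (hf z hz).2.fun_add (hg z hz).2
  | monomial k a =>
    refine ⟨fun z => a * (((2 : ℂ) ^ k)⁻¹ * k.factorial *
      (π * (2 * k * ((Complex.sin (π * z)) ^ (2 * k))⁻¹ -
        (2 * k + 1) * ((Complex.sin (π * z)) ^ (2 * k + 2))⁻¹))), fun z hz => ⟨?_, ?_⟩⟩
    · simp only [cotPoly_monomial]
      exact ((hasDerivAt_cos_mul_sin_pow_inv hz k).const_mul _).const_mul _
    · have h := ((((hasDerivAt_sin_pi_mul_pow_inv hz (2 * k)).const_mul (2 * (k : ℂ))).fun_sub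
        ((hasDerivAt_sin_pi_mul_pow_inv hz (2 * k + 2)).const_mul (2 * (k : ℂ) + 1))).const_mul
        (π : ℂ)).const_mul (((2 : ℂ) ^ k)⁻¹ * k.factorial) |>.const_mul (a : ℂ)
      refine h.congr_deriv ?_
      have e : (monomial k a : ℝ[X]) = a • X ^ k := by rw [smul_X_eq_monomial]
      have e1 (j : ℕ) : (X ^ j : ℝ[X]) = monomial j 1 := by rw [X_pow_eq_monomial]
      rw [e, map_smul, map_smul, besselStep_X_pow, map_sub, map_smul, map_smul, e1, e1,
        cotPoly_monomial, cotPoly_monomial, Nat.factorial_succ]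
      simp only [Complex.real_smul]
      push_cast
      field_simp
      ring

theorem iteratedDerivWithin_cot_eq_cotPoly (n : ℕ) :
    Set.EqOn (iteratedDerivWithin (2 * n) (fun x : ℂ => π * Complex.cot (π * x))
        UpperHalfPlane.upperHalfPlaneSet)
      (fun z => π * (-(4 * π ^ 2)) ^ n * cotPoly z (besselPoly n))
      UpperHalfPlane.upperHalfPlaneSet := by
  have hU := UpperHalfPlane.isOpen_upperHalfPlaneSet
  have hs : ∀ z ∈ UpperHalfPlane.upperHalfPlaneSet, Complex.sin (π * z) ≠ 0 := fun z hz =>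
    sin_pi_mul_ne_zero (UpperHalfPlane.coe_mem_integerComplement ⟨z, hz⟩)
  induction n with
  | zero =>
    intro z hz
    have : (1 : ℝ[X]) = monomial 0 1 := rfl
    simp [besselPoly_zero, this, cotPoly_monomial, -monomial_zero_left, Complex.cot, div_eq_mul_inv]
  | succ n ih =>
    obtain ⟨f, hf⟩ := exists_hasDerivAt_cotPoly (besselPoly n)
    have h1 : Set.EqOn (iteratedDerivWithin (2 * n + 1) (fun x : ℂ => π * Complex.cot (π * x))
        UpperHalfPlane.upperHalfPlaneSet) (fun z => π * (-(4 * π ^ 2)) ^ n * f z)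
        UpperHalfPlane.upperHalfPlaneSet := by
      intro z hz
      rw [iteratedDerivWithin_succ, derivWithin_congr ih (ih hz), derivWithin_of_isOpen hU hz]
      exact ((hf z (hs z hz)).1.const_mul _).deriv
    intro z hz
    rw [show 2 * (n + 1) = 2 * n + 1 + 1 by ring, iteratedDerivWithin_succ,
      derivWithin_congr h1 (h1 hz), derivWithin_of_isOpen hU hz, besselPoly_succ]
    refine ((hf z (hs z hz)).2.const_mul _).deriv.trans ?_
    ring

theorem cotPoly_besselPoly_eq_tsum {n : ℕ} (hn : 1 ≤ n) {z : ℂ} (hz : 0 < z.im) :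
    π * (-(4 * π ^ 2)) ^ n * cotPoly z (besselPoly n) =
      (2 * n).factorial * ∑' m : ℤ, ((z + m) ^ (2 * n + 1))⁻¹ := by
  have h := iteratedDerivWithin_cot_eq_cotPoly n (x := z) hz
  rw [iteratedDerivWithin_cot_pi_mul_eq_mul_tsum_div_pow (by omega) hz] at h
  simpa using h.symm

theorem cotPoly_mul_I_div {x : ℝ} (n : ℕ) (hn : 1 ≤ n) :
    Complex.I * cotPoly (1 / 2 + Complex.I * x / π) (besselPoly n) / x =
      ((∑ k ∈ Finset.Icc 1 n, ((2 : ℝ) ^ k)⁻¹ * (k.factorial : ℝ) * besselCoeff n k *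
        hIntegrand (2 * k + 1) x : ℝ) : ℂ) := by
  have hpi : (π : ℂ) ≠ 0 := Complex.ofReal_ne_zero.mpr pi_ne_zero
  -- The shift by `1/2` exchanges sine and cosine, so the power in the denominator becomes one of
  -- `cosh x`, free of zeros.
  have e : (π : ℂ) * (1 / 2 + Complex.I * x / π) = x * Complex.I + π / 2 := by
    field_simp; ring
  have hs : Complex.sin (π * (1 / 2 + Complex.I * x / π)) = Complex.cosh x := by
    rw [e, Complex.sin_add_pi_div_two, Complex.cos_mul_I]
  have hc : Complex.cos (π * (1 / 2 + Complex.I * x / π)) = -(Complex.sinh x * Complex.I) := by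
    rw [e, Complex.cos_add_pi_div_two, Complex.sin_mul_I]
  have h0 : cotPoly (1 / 2 + Complex.I * x / π) (besselPoly n) = ∑ k ∈ Finset.Icc 1 n,
      (besselCoeff n k : ℂ) * (((2 : ℂ) ^ k)⁻¹ * k.factorial *
        (-(Complex.sinh x * Complex.I) * ((Complex.cosh x) ^ (2 * k + 1))⁻¹)) := by
    conv_lhs => rw [(besselPoly n).as_sum_range' (n + 1)
      (Nat.lt_succ_of_le (natDegree_besselPoly_le n))]
    rw [map_sum, Finset.sum_range_succ', besselPoly_coeff_zero hn, map_zero, map_zero, add_zero,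
      sum_range_comp_succ fun k => cotPoly (1 / 2 + Complex.I * x / π)
        (monomial k ((besselPoly n).coeff k))]
    refine Finset.sum_congr rfl fun k _ => ?_
    rw [cotPoly_monomial, hs, hc, besselCoeff]
  rw [h0, Finset.mul_sum, Finset.sum_div, Complex.ofReal_sum]
  refine Finset.sum_congr rfl fun k _ => ?_
  simp only [hIntegrand]
  push_cast
  simp only [div_eq_mul_inv, mul_inv]
  linear_combination (-(besselCoeff n k * (((2 : ℂ) ^ k)⁻¹ * k.factorial *
        (Complex.sinh x * ((Complex.cosh x) ^ (2 * k + 1))⁻¹)) * (x : ℂ)⁻¹)) * Complex.I_sq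

/-! ### Integrals of the pole kernel -/

theorem one_add_I_mul_ne_zero (y : ℝ) : 1 + Complex.I * y ≠ 0 := fun h => by
  simpa using congrArg Complex.re h

theorem one_sub_I_mul_ne_zero (y : ℝ) : 1 - Complex.I * y ≠ 0 := fun h => by
  simpa using congrArg Complex.re h

theorem hasDerivAt_one_add_mul_pow_inv (c : ℂ) (N : ℕ) {y : ℝ} (hy : 1 + c * y ≠ 0) :
    HasDerivAt (fun t : ℝ => ((1 + c * t) ^ N)⁻¹) (-(N * c * ((1 + c * y) ^ (N + 1))⁻¹)) y := by
  have h1 : HasDerivAt (fun t : ℝ => 1 + c * (t : ℂ)) c y := by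
    simpa using ((Complex.ofRealCLM.hasDerivAt (x := y)).const_mul c).const_add 1
  refine (h1.fun_pow N).fun_inv (pow_ne_zero _ hy) |>.congr_deriv ?_
  rcases N with - | N
  · simp
  · simp only [Nat.add_sub_cancel]
    field_simp
    ring

theorem norm_one_add_mul_pow_inv_le (c : ℂ) (hc : c = Complex.I ∨ c = -Complex.I) (N : ℕ) (y : ℝ) :
    ‖((1 + c * y) ^ (N + 2))⁻¹‖ ≤ (1 + y ^ 2)⁻¹ := by
  have hsq : ‖1 + c * y‖ ^ 2 = 1 + y ^ 2 := by
    rw [Complex.sq_norm, Complex.normSq_apply]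
    rcases hc with rfl | rfl <;> simp <;> ring
  have h1 : 1 ≤ ‖1 + c * y‖ := by
    nlinarith [norm_nonneg (1 + c * y), sq_nonneg y]
  rw [norm_inv, norm_pow, ← hsq]
  exact inv_anti₀ (by positivity) (pow_le_pow_right₀ h1 (by omega))

theorem tendsto_one_add_mul_pow_inv (c : ℂ) (hc : c ≠ 0) (N : ℕ) :
    Filter.Tendsto (fun t : ℝ => ((1 + c * t) ^ (N + 1))⁻¹) Filter.atTop (nhds 0) := by
  have h1 : Filter.Tendsto (fun t : ℝ => ‖1 + c * t‖) Filter.atTop Filter.atTop := by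
    refine Filter.tendsto_atTop_mono (f := fun t : ℝ => ‖c‖ * t - 1) (fun t => ?_) ?_
    · have h2 := norm_sub_norm_le (c * t) (-1)
      rw [norm_mul, norm_neg, norm_one, sub_neg_eq_add, add_comm (c * (t : ℂ)),
        Complex.norm_real, norm_eq_abs] at h2
      nlinarith [le_abs_self t, norm_nonneg c]
    · exact Filter.tendsto_atTop_add_const_right _ _
        (Filter.tendsto_id.const_mul_atTop (norm_pos_iff.mpr hc))
  rw [tendsto_zero_iff_norm_tendsto_zero]
  simp only [norm_inv, norm_pow]
  exact ((Filter.tendsto_pow_atTop (Nat.succ_ne_zero N)).comp h1).inv_tendsto_atTop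

theorem integrable_one_add_mul_pow_inv (c : ℂ) (hc : c = Complex.I ∨ c = -Complex.I) (N : ℕ) :
    IntegrableOn (fun y : ℝ => ((1 + c * y) ^ (N + 2))⁻¹) (Set.Ioi 0) := by
  have hne : ∀ y : ℝ, 1 + c * y ≠ 0 := fun y => by
    rcases hc with rfl | rfl
    · exact one_add_I_mul_ne_zero y
    · simpa [sub_eq_add_neg] using one_sub_I_mul_ne_zero y
  refine (integrable_inv_one_add_sq.mono' ?_
    (Filter.Eventually.of_forall (norm_one_add_mul_pow_inv_le c hc N))).integrableOn
  refine Continuous.aestronglyMeasurable ?_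
  exact Continuous.inv₀ (by fun_prop) fun y => pow_ne_zero _ (hne y)

theorem integral_one_add_mul_pow_inv (c : ℂ) (hc : c = Complex.I ∨ c = -Complex.I) (N : ℕ) :
    ∫ y in Set.Ioi (0 : ℝ), ((1 + c * y) ^ (N + 2))⁻¹ = ((N + 1) * c)⁻¹ := by
  have hne : ∀ y : ℝ, 1 + c * y ≠ 0 := fun y => by
    rcases hc with rfl | rfl
    · exact one_add_I_mul_ne_zero y
    · simpa [sub_eq_add_neg] using one_sub_I_mul_ne_zero y
  have hc0 : c ≠ 0 := by rcases hc with rfl | rfl <;> simp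
  have hN : (N : ℂ) + 1 ≠ 0 := by exact_mod_cast Nat.succ_ne_zero N
  have h := integral_Ioi_of_hasDerivAt_of_tendsto' (a := 0) (m := 0)
    (f := fun t : ℝ => -((N + 1) * c)⁻¹ * ((1 + c * t) ^ (N + 1))⁻¹)
    (f' := fun y : ℝ => ((1 + c * y) ^ (N + 2))⁻¹)
    (fun y _ => ((hasDerivAt_one_add_mul_pow_inv c (N + 1) (hne y)).const_mul _).congr_deriv
      (by push_cast; field_simp)) (integrable_one_add_mul_pow_inv c hc N)
    (by simpa using (tendsto_one_add_mul_pow_inv c hc0 N).const_mul (-((N + 1) * c)⁻¹))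
  rw [h]
  simp

/-- The integrand `((1 + i y)⁻ᴺ - (1 - i y)⁻ᴺ) / y`. -/
def poleKernel (N : ℕ) (y : ℝ) : ℂ :=
  (((1 + Complex.I * y) ^ N)⁻¹ - ((1 - Complex.I * y) ^ N)⁻¹) / y

/-- The integral does not depend on the exponent. For exponent one the kernel is `-2i / (1 + y²)`;
raising the exponent adds `-i` times two conjugate powers, whose integrals `±((N+1)i)⁻¹` cancel. -/
theorem integrableOn_and_integral_poleKernel (N : ℕ) :
    IntegrableOn (poleKernel (N + 1)) (Set.Ioi 0) ∧
    ∫ y in Set.Ioi (0 : ℝ), poleKernel (N + 1) y = -(Complex.I * π) := by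
  induction N with
  | zero =>
    have e : Set.EqOn (fun y : ℝ => -(2 * Complex.I) * (((1 + y ^ 2)⁻¹ : ℝ) : ℂ))
        (poleKernel (0 + 1)) (Set.Ioi 0) := by
      intro y hy
      have hy0 : (y : ℂ) ≠ 0 := Complex.ofReal_ne_zero.mpr (ne_of_gt hy)
      have h1 := one_add_I_mul_ne_zero y
      have h2 := one_sub_I_mul_ne_zero y
      have h3 : (1 + (y : ℂ) ^ 2) = (1 + Complex.I * y) * (1 - Complex.I * y) := by
        linear_combination (y : ℂ) ^ 2 * Complex.I_sq
      simp only [poleKernel]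
      push_cast
      rw [h3]
      field_simp
      ring
    constructor
    · exact (((integrable_inv_one_add_sq.ofReal).const_mul _).integrableOn).congr_fun e
        measurableSet_Ioi
    · rw [← setIntegral_congr_fun measurableSet_Ioi e, integral_const_mul, integral_complex_ofReal,
        integral_Ioi_inv_one_add_sq]
      simp only [arctan_zero, sub_zero]
      push_cast
      ring
  | succ N ih =>
    -- With `a = 1 ± iy`, this is `a^(-N-2) = a^(-N-1) ∓ iy a^(-N-2)`; the factor `y` cancels the
    -- denominator.
    have e : Set.EqOn (fun y : ℝ => poleKernel (N + 1) y -
        Complex.I * (((1 + Complex.I * y) ^ (N + 2))⁻¹ + ((1 + -Complex.I * y) ^ (N + 2))⁻¹))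
        (poleKernel (N + 1 + 1)) (Set.Ioi 0) := by
      intro y hy
      have hy0 : (y : ℂ) ≠ 0 := Complex.ofReal_ne_zero.mpr (ne_of_gt hy)
      have h1 := one_add_I_mul_ne_zero y
      have h2 := one_sub_I_mul_ne_zero y
      have h3 : 1 + -Complex.I * y = 1 - Complex.I * y := by ring
      simp only [poleKernel, h3]
      field_simp
      ring
    have i1 := integrable_one_add_mul_pow_inv Complex.I (Or.inl rfl) N
    have i2 := integrable_one_add_mul_pow_inv (-Complex.I) (Or.inr rfl) N
    have i3 := Integrable.const_mul (Integrable.fun_add i1 i2) Complex.I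
    constructor
    · exact (ih.1.sub i3).congr_fun e measurableSet_Ioi
    · rw [← setIntegral_congr_fun measurableSet_Ioi e,
        integral_sub ih.1 i3, ih.2, integral_const_mul,
        integral_add i1 i2, integral_one_add_mul_pow_inv _ (Or.inl rfl),
        integral_one_add_mul_pow_inv _ (Or.inr rfl)]
      simp

/-! ### Convergence of the integrals -/

theorem sinh_le_mul_cosh {x : ℝ} (hx : 0 ≤ x) : sinh x ≤ x * cosh x := by
  have hd : ∀ y : ℝ, HasDerivAt (fun y => y * cosh y - sinh y) (y * sinh y) y := fun y =>
    (((hasDerivAt_id y).fun_mul (hasDerivAt_cosh y)).fun_sub (hasDerivAt_sinh y)).congr_deriv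
      (by simp)
  have hm : MonotoneOn (fun y => y * cosh y - sinh y) (Set.Ici 0) := by
    refine monotoneOn_of_deriv_nonneg (convex_Ici 0)
      (fun y _ => (hd y).continuousAt.continuousWithinAt)
      (fun y _ => (hd y).differentiableAt.differentiableWithinAt) fun y hy => ?_
    rw [interior_Ici] at hy
    rw [(hd y).deriv]
    exact mul_nonneg hy.le (sinh_nonneg_iff.mpr hy.le)
  simpa using hm (Set.self_mem_Ici) hx hx

/-- One power of `cosh x` absorbs `sinh x / x`, and the remaining `2n ≥ 2` powers dominate `1 + x²`.
-/
theorem integrableOn_hIntegrand {n : ℕ} (hn : 1 ≤ n) :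
    IntegrableOn (hIntegrand (2 * n + 1)) (Set.Ioi (0 : ℝ)) := by
  refine (integrable_inv_one_add_sq.integrableOn (s := Set.Ioi 0)).mono' ?_ ?_
  · refine ContinuousOn.aestronglyMeasurable ?_ measurableSet_Ioi
    refine ContinuousOn.div (by fun_prop) (by fun_prop) fun x hx => ?_
    exact mul_ne_zero (ne_of_gt hx) (pow_ne_zero _ (cosh_pos x).ne')
  · refine (ae_restrict_mem measurableSet_Ioi).mono fun x (hx : 0 < x) => ?_
    have hc := cosh_pos x
    have hs : x ≤ sinh x := self_le_sinh_iff.mpr hx.le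
    have h1 : 1 + x ^ 2 ≤ cosh x ^ 2 := by
      rw [cosh_sq]; nlinarith
    have h2 : cosh x ^ 2 ≤ cosh x ^ (2 * n) := pow_le_pow_right₀ (one_le_cosh x) (by omega)
    rw [hIntegrand, norm_eq_abs, abs_of_nonneg (div_nonneg (by linarith) (by positivity)),
      div_le_iff₀ (by positivity), inv_mul_eq_div, le_div_iff₀ (by positivity)]
    calc sinh x * (1 + x ^ 2) ≤ (x * cosh x) * cosh x ^ (2 * n) :=
          mul_le_mul (sinh_le_mul_cosh hx.le) (h1.trans h2) (by positivity) (by positivity)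
      _ = x * cosh x ^ (2 * n + 1) := by ring

/-! ### Odd zeta values from paired poles -/

theorem hasSum_half_add_pow_inv {N : ℕ} (hN : 1 < N) :
    HasSum (fun m : ℕ => (((m : ℂ) + 1 / 2) ^ N)⁻¹) ((2 ^ N - 1) * riemannZeta N) := by
  have hsum : Summable fun n : ℕ => 1 / (n : ℂ) ^ N := by
    simpa using (Complex.summable_one_div_nat_cpow (p := N)).mpr (by simpa using hN)
  have h2 : Function.Injective fun k : ℕ => 2 * k := fun a b h => by simpa using h
  have h3 : Function.Injective fun k : ℕ => 2 * k + 1 := fun a b h => by simpa using h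
  have he := hsum.comp_injective h2
  have ho := hsum.comp_injective h3
  have hz := zeta_nat_eq_tsum_of_gt_one hN
  have hadd := tsum_even_add_odd (f := fun n : ℕ => 1 / (n : ℂ) ^ N) he ho
  have p2 : (2 : ℂ) ^ N ≠ 0 := pow_ne_zero _ two_ne_zero
  have e1 : ∑' k : ℕ, 1 / ((2 * k : ℕ) : ℂ) ^ N = ((2 : ℂ) ^ N)⁻¹ * riemannZeta N := by
    rw [hz, ← tsum_mul_left]
    refine tsum_congr fun k => ?_
    push_cast
    rw [mul_pow, one_div, one_div, mul_inv]
  have e2 : (fun m : ℕ => (((m : ℂ) + 1 / 2) ^ N)⁻¹) =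
      fun m : ℕ => (2 : ℂ) ^ N * (1 / ((2 * m + 1 : ℕ) : ℂ) ^ N) := by
    funext m
    rw [show ((2 * m + 1 : ℕ) : ℂ) = 2 * ((m : ℂ) + 1 / 2) by push_cast; ring, mul_pow]
    field_simp
  rw [e2]
  have e3 : ∑' k : ℕ, 1 / ((2 * k + 1 : ℕ) : ℂ) ^ N =
      riemannZeta N - ((2 : ℂ) ^ N)⁻¹ * riemannZeta N := by
    rw [← e1, hz, ← hadd, add_sub_cancel_left]
  have e4 := ho.hasSum.mul_left ((2 : ℂ) ^ N)
  simp only [Function.comp_def] at e4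
  rwa [e3, mul_sub, mul_inv_cancel_left₀ p2, ← sub_one_mul] at e4

/-- The contribution of the pair of poles `± (m + 1/2)` to the partial fraction expansion. -/
def polePair (N m : ℕ) (x : ℝ) : ℂ :=
  (((m : ℂ) + 1 / 2) ^ N)⁻¹ *
    (((π * (m + 1 / 2))⁻¹ : ℝ) * poleKernel N ((π * (m + 1 / 2))⁻¹ * x))

theorem integrableOn_polePair (N m : ℕ) :
    IntegrableOn (polePair (N + 1) m) (Set.Ioi (0 : ℝ)) := by
  have ha : 0 < (π * ((m : ℝ) + 1 / 2))⁻¹ := by positivity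
  refine Integrable.const_mul (Integrable.const_mul ?_ _) _
  refine (integrableOn_Ioi_comp_mul_left_iff (poleKernel (N + 1)) 0 ha).mpr ?_
  rw [mul_zero]
  exact (integrableOn_and_integral_poleKernel N).1

/-- Rescaling `x` by `π(m + 1/2)` reduces this to the kernel, the Jacobian cancelling the prefactor.
-/
theorem integral_polePair (N m : ℕ) :
    ∫ x in Set.Ioi (0 : ℝ), polePair (N + 1) m x =
      (((m : ℂ) + 1 / 2) ^ (N + 1))⁻¹ * -(Complex.I * π) := by
  have ha : 0 < (π * ((m : ℝ) + 1 / 2))⁻¹ := by positivity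
  simp only [polePair]
  rw [integral_const_mul, integral_const_mul, integral_comp_mul_left_Ioi _ _ ha, mul_zero,
    (integrableOn_and_integral_poleKernel N).2, Complex.real_smul, Complex.ofReal_inv (_⁻¹),
    mul_inv_cancel_left₀ (Complex.ofReal_ne_zero.mpr ha.ne')]

theorem integral_norm_polePair (N m : ℕ) :
    ∫ x in Set.Ioi (0 : ℝ), ‖polePair (N + 1) m x‖ =
      ‖(((m : ℂ) + 1 / 2) ^ (N + 1))⁻¹‖ * ∫ y in Set.Ioi (0 : ℝ), ‖poleKernel (N + 1) y‖ := by
  have ha : 0 < (π * ((m : ℝ) + 1 / 2))⁻¹ := by positivity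
  simp only [polePair, norm_mul]
  rw [integral_const_mul, integral_const_mul,
    integral_comp_mul_left_Ioi (fun y => ‖poleKernel (N + 1) y‖) _ ha, mul_zero, Complex.norm_real,
    norm_of_nonneg ha.le, smul_eq_mul, mul_inv_cancel_left₀ ha.ne']

/-- The integrals of the norms are a fixed constant times `(m + 1/2)^(-N-1)`, summable for `N ≥ 1`,
so sum and integral may be exchanged. -/
theorem integral_tsum_polePair {N : ℕ} (hN : 1 ≤ N) :
    ∫ x in Set.Ioi (0 : ℝ), ∑' m : ℕ, polePair (N + 1) m x =
      (2 ^ (N + 1) - 1) * riemannZeta (N + 1 : ℕ) * -(Complex.I * π) := by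
  have hz := hasSum_half_add_pow_inv (N := N + 1) (by omega)
  have h := hasSum_integral_of_summable_integral_norm (integrableOn_polePair N) (by
    simp only [integral_norm_polePair]
    exact hz.summable.norm.mul_right _)
  simp only [integral_polePair] at h
  exact h.unique (hz.mul_right _)

/-- The index `m` is paired with `-(m+1)`. As the exponent is odd, the pair is a difference that
vanishes at `x = 0`, which makes division by `x` harmless; single terms would not be integrable. -/
theorem tsum_int_pow_inv_div {n : ℕ} (hn : 1 ≤ n) {x : ℝ} (hx : 0 < x) :
    (∑' m : ℤ, ((1 / 2 + Complex.I * x / π + m) ^ (2 * n + 1))⁻¹) / x =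
      ∑' m : ℕ, polePair (2 * n + 1) m x := by
  have hpi : (π : ℂ) ≠ 0 := Complex.ofReal_ne_zero.mpr pi_ne_zero
  have hx0 : (x : ℂ) ≠ 0 := Complex.ofReal_ne_zero.mpr hx.ne'
  have hs : Summable fun m : ℤ => ((1 / 2 + Complex.I * x / π + m) ^ (2 * n + 1))⁻¹ := by
    have := EisensteinSeries.linear_right_summable (1 / 2 + Complex.I * x / π) 1
      (k := (2 * n + 1 : ℕ)) (by omega)
    simpa only [Int.cast_one, one_mul, zpow_natCast] using this
  have i1 : Function.Injective fun k : ℕ => (k : ℤ) := Nat.cast_injective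
  have i2 : Function.Injective fun k : ℕ => -((k : ℤ) + 1) := fun a b h => by simpa using h
  have s1 := hs.comp_injective i1
  have s2 := hs.comp_injective i2
  rw [tsum_of_nat_of_neg_add_one (f := fun m : ℤ =>
    ((1 / 2 + Complex.I * x / π + m) ^ (2 * n + 1))⁻¹) s1 s2]
  refine (congrArg (· / (x : ℂ)) (s1.tsum_add s2).symm).trans ?_
  rw [← tsum_div_const]
  refine tsum_congr fun m => ?_
  have hm : ((m : ℂ) + 1 / 2) ≠ 0 := by
    have h : ((m + 1 / 2 : ℝ) : ℂ) ≠ 0 := Complex.ofReal_ne_zero.mpr (by positivity)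
    simpa using h
  have hc : (((π * (m + 1 / 2))⁻¹ : ℝ) : ℂ) = (π * ((m : ℂ) + 1 / 2))⁻¹ := by push_cast; rfl
  have e1 : 1 / 2 + Complex.I * x / π + ((m : ℤ) : ℂ) = ((m : ℂ) + 1 / 2) *
      (1 + Complex.I * (((π * (m + 1 / 2))⁻¹ * x : ℝ) : ℂ)) := by
    rw [Complex.ofReal_mul, hc, Int.cast_natCast,
      show 1 / 2 + Complex.I * x / π + (m : ℂ) = ((m : ℂ) + 1 / 2) + Complex.I * x / π by ring]
    generalize (m : ℂ) + 1 / 2 = b at hm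
    field_simp
  have e2 : 1 / 2 + Complex.I * x / π + ((-((m : ℤ) + 1) : ℤ) : ℂ) = -(((m : ℂ) + 1 / 2) *
      (1 - Complex.I * (((π * (m + 1 / 2))⁻¹ * x : ℝ) : ℂ))) := by
    rw [Complex.ofReal_mul, hc,
      show 1 / 2 + Complex.I * x / π + ((-((m : ℤ) + 1) : ℤ) : ℂ) =
        -((m : ℂ) + 1 / 2) + Complex.I * x / π by push_cast; ring]
    generalize (m : ℂ) + 1 / 2 = b at hm
    field_simp
    ring
  simp only [Function.comp_def]
  rw [e1, e2, Odd.neg_pow ⟨n, rfl⟩, mul_pow, mul_pow, polePair, poleKernel, inv_neg,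
    mul_inv (_ ^ _), mul_inv (_ ^ _)]
  generalize ((1 + Complex.I * (((π * (m + 1 / 2))⁻¹ * x : ℝ) : ℂ)) ^ (2 * n + 1))⁻¹ = u
  generalize ((1 - Complex.I * (((π * (m + 1 / 2))⁻¹ * x : ℝ) : ℂ)) ^ (2 * n + 1))⁻¹ = v
  rw [Complex.ofReal_mul, hc]
  generalize (m : ℂ) + 1 / 2 = b at hm
  field_simp
  ring

/-! ### The two equalities -/

theorem sum_besselCoeff_mul_h {n : ℕ} (hn : 1 ≤ n) :
    ((∑ k ∈ Finset.Icc 1 n, ((2 : ℝ) ^ k)⁻¹ * (k.factorial : ℝ) * besselCoeff n k *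
        h (2 * k + 1) : ℝ) : ℂ) =
      (-1) ^ n * (((2 * n).factorial : ℂ) * (2 ^ (2 * n + 1) - 1) *
        (riemannZeta (2 * (n : ℂ) + 1) / (2 * (π : ℂ)) ^ (2 * n))) := by
  have hpi : (π : ℂ) ≠ 0 := Complex.ofReal_ne_zero.mpr pi_ne_zero
  have h1 : ∑ k ∈ Finset.Icc 1 n, ((2 : ℝ) ^ k)⁻¹ * (k.factorial : ℝ) * besselCoeff n k *
        h (2 * k + 1) = ∫ x in Set.Ioi (0 : ℝ), ∑ k ∈ Finset.Icc 1 n,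
          ((2 : ℝ) ^ k)⁻¹ * (k.factorial : ℝ) * besselCoeff n k * hIntegrand (2 * k + 1) x := by
    rw [integral_finsetSum _ fun k hk =>
      (integrableOn_hIntegrand (Finset.mem_Icc.mp hk).1).const_mul _]
    simp only [integral_const_mul, h]
  have hA : (π : ℂ) * (-(4 * π ^ 2)) ^ n ≠ 0 :=
    mul_ne_zero hpi (pow_ne_zero _ (neg_ne_zero.mpr (mul_ne_zero (by norm_num) (pow_ne_zero _ hpi))))
  have e : Set.EqOn (fun x : ℝ => ((∑ k ∈ Finset.Icc 1 n, ((2 : ℝ) ^ k)⁻¹ * (k.factorial : ℝ) *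
      besselCoeff n k * hIntegrand (2 * k + 1) x : ℝ) : ℂ))
      (fun x => Complex.I * (2 * n).factorial / (π * (-(4 * π ^ 2)) ^ n) *
        ∑' m : ℕ, polePair (2 * n + 1) m x) (Set.Ioi 0) := by
    intro x hx
    have hx' : (0 : ℝ) < x := hx
    have him : 0 < (1 / 2 + Complex.I * x / π : ℂ).im := by
      have : (1 / 2 + Complex.I * x / π : ℂ) = ((1 / 2 : ℝ) : ℂ) + ((x / π : ℝ) : ℂ) * Complex.I := by
        push_cast; ring
      rw [this]
      simpa using div_pos hx' pi_pos
    have h2 := cotPoly_besselPoly_eq_tsum hn him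
    simp only []
    rw [← cotPoly_mul_I_div n hn, ← tsum_int_pow_inv_div hn hx',
      eq_div_of_mul_eq hA ((mul_comm _ _).trans h2)]
    ring
  -- The two factors `I`, one from `cos(πz) = -i sinh x` and one from the kernel integral, combine
  -- to make the result real.
  rw [h1, ← integral_complex_ofReal, setIntegral_congr_fun measurableSet_Ioi e, integral_const_mul,
    integral_tsum_polePair (by omega)]
  have h3 : (-1 : ℂ) ^ n * (-1) ^ n = 1 := by rw [← mul_pow]; simp
  have h4 : (-(4 * (π : ℂ) ^ 2)) ^ n = (-1) ^ n * (2 * π) ^ (2 * n) := by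
    rw [pow_mul, ← mul_pow]; ring
  rw [h4]
  have h5 : ((2 * n + 1 : ℕ) : ℂ) = 2 * n + 1 := by push_cast; rfl
  rw [h5]
  have h6 : (2 * (π : ℂ)) ^ (2 * n) ≠ 0 := pow_ne_zero _ (mul_ne_zero two_ne_zero hpi)
  have h7 : (-1 : ℂ) ^ n ≠ 0 := by simp
  generalize (2 * (π : ℂ)) ^ (2 * n) = P at h6
  generalize (-1 : ℂ) ^ n = s at h3 h7
  generalize (2 : ℂ) ^ (2 * n + 1) - 1 = t
  field_simp
  linear_combination (-((2 * n).factorial * t * riemannZeta (2 * n + 1))) * (h3 + Complex.I_sq)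

/-- The functional on polynomials that sends `X ^ k` to `2⁻ᵏ k! h_{2k+1}` for `k ≥ 1`, and `1`
to `0`. -/
def hFunctional : ℝ[X] →ₗ[ℝ] ℝ :=
  Polynomial.lsum fun k => LinearMap.toSpanSingleton ℝ ℝ
    (if k = 0 then 0 else ((2 : ℝ) ^ k)⁻¹ * k.factorial * h (2 * k + 1))

theorem hFunctional_monomial {k : ℕ} (hk : k ≠ 0) (a : ℝ) :
    hFunctional (monomial k a) = ((2 : ℝ) ^ k)⁻¹ * k.factorial * a * h (2 * k + 1) := by
  simp only [hFunctional, lsum_apply, LinearMap.toSpanSingleton_apply, smul_eq_mul, zero_mul,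
    sum_monomial_index, if_neg hk]
  ring

theorem hFunctional_monomial_zero (a : ℝ) : hFunctional (monomial 0 a) = 0 := by
  simp [hFunctional, sum_monomial_index, -monomial_zero_left]

theorem hFunctional_besselPoly (n : ℕ) : hFunctional (besselPoly n) =
    ∑ k ∈ Finset.Icc 1 n, ((2 : ℝ) ^ k)⁻¹ * (k.factorial : ℝ) * besselCoeff n k *
      h (2 * k + 1) := by
  conv_lhs => rw [(besselPoly n).as_sum_range' (n + 1)
    (Nat.lt_succ_of_le (natDegree_besselPoly_le n))]
  rw [map_sum, Finset.sum_range_succ', hFunctional_monomial_zero, add_zero,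
    sum_range_comp_succ fun k => hFunctional (monomial k ((besselPoly n).coeff k))]
  refine Finset.sum_congr rfl fun k hk => ?_
  rw [hFunctional_monomial (by have := (Finset.mem_Icc.mp hk).1; omega), besselCoeff]

/-- Applying `hFunctional` to the inversion formula isolates `h_{2n+1}`; its constant simplifies
because `2^n n!` times the product of the odd numbers below `2n` is `(2n)!`. -/
theorem h_eq_sum_centralFactorial {n : ℕ} (hn : 1 ≤ n) : h (2 * n + 1) =
    (-1) ^ n * 4 ^ n / (2 * n).factorial *
      ∑ k ∈ Finset.Icc 1 n, centralFactorial (2 * n) (2 * k) * hFunctional (besselPoly k) := by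
  have h1 := congrArg hFunctional (sum_centralFactorial_smul_besselPoly n)
  rw [map_sum, Finset.sum_range_succ', map_smul, map_smul, besselPoly_zero,
    show (1 : ℝ[X]) = monomial 0 1 from rfl, hFunctional_monomial_zero, smul_zero, add_zero,
    sum_range_comp_succ fun k => hFunctional (centralFactorial (2 * n) (2 * k) • besselPoly k),
    X_pow_eq_monomial, hFunctional_monomial (by omega)] at h1
  simp only [map_smul, smul_eq_mul] at h1
  have h3 : (-1 : ℝ) ^ n * (-1) ^ n = 1 := by rw [← mul_pow]; simp
  have h4 : (4 : ℝ) ^ n = 2 ^ n * 2 ^ n := by rw [← mul_pow]; norm_num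
  have h5 : ∏ j ∈ Finset.range n, (2 * (j : ℝ) + 1) ≠ 0 :=
    Finset.prod_ne_zero_iff.mpr fun j _ => by positivity
  rw [h1, ← two_pow_mul_factorial_mul_prod_odd, h4]
  field_simp
  linear_combination -h (2 * n + 1) * h3

end OddZeta
end

theorem theorem5 (n : ℕ) (hn : 1 ≤ n) :
    IntegrableOn (OddZeta.hIntegrand (2 * n + 1)) (Set.Ioi (0 : ℝ)) ∧
    ((2 * n).factorial : ℂ) * (2 ^ (2 * n + 1) - 1) *
        (riemannZeta (2 * (n : ℂ) + 1) / (2 * (Real.pi : ℂ)) ^ (2 * n)) =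
      (((-1) ^ n * ∑ k ∈ Finset.Icc 1 n, ((2 : ℝ) ^ k)⁻¹ * (k.factorial : ℝ) *
        OddZeta.besselCoeff n k * OddZeta.h (2 * k + 1) : ℝ) : ℂ) ∧
    (OddZeta.h (2 * n + 1) : ℂ) =
      (-1) ^ n * 4 ^ n / ((2 * n).factorial : ℂ) *
        ∑ k ∈ Finset.Icc 1 n, (-1) ^ k * (OddZeta.centralFactorial (2 * n) (2 * k) : ℂ) *
          ((2 * k).factorial : ℂ) * (2 ^ (2 * k + 1) - 1) *
          (riemannZeta (2 * (k : ℂ) + 1) / (2 * (Real.pi : ℂ)) ^ (2 * k)) := by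
  refine ⟨OddZeta.integrableOn_hIntegrand hn, ?_, ?_⟩
  · have h3 : (-1 : ℂ) ^ n * (-1) ^ n = 1 := by rw [← mul_pow]; simp
    rw [Complex.ofReal_mul, OddZeta.sum_besselCoeff_mul_h hn, ← mul_assoc, Complex.ofReal_pow,
      Complex.ofReal_neg, Complex.ofReal_one, h3, one_mul]
  · rw [OddZeta.h_eq_sum_centralFactorial hn]
    push_cast
    congr 1
    refine Finset.sum_congr rfl fun k hk => ?_
    rw [OddZeta.hFunctional_besselPoly, OddZeta.sum_besselCoeff_mul_h (Finset.mem_Icc.mp hk).1]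
    ring
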